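/- A semilattice is a partially ordered set $(K,\le)$ in which any two elements $x,y$ have a supremum $x\oplus y$. A subset $T\subseteq K$ is called convex if it is a subsemilattice, i.e. $x\oplus y\in T$ whenever $x,y\in T$ (so $\emptyset$ is convex). A topological semilattice is a semilattice with a Hausdorff topology for which $\oplus : K\times K\to K$ is continuous; it is locally convex if every point has a neighbourhood basis consisting of convex sets. (1) Let $K$ be a locally compact and locally convex topological semilattice, let $A\subseteq K$ be compact and convex, and let $x\in K\setminus A$. Then there is an open convex set $V\supseteq A$ such that $x\notin\overline{V}$. (2) Let $K$ be a compact locally convex topological semilattice, and let $A,B\subseteq K$ be disjoint closed convex subsets. Then there is a closed convex neighbourhood $N$ of $A$ (that is, $A\subseteq \operatorname{int} N$) with $N\cap B=\emptyset$. -/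

import Mathlib

open scoped Topology

/-- The convex subsets of a (join-)semilattice are its subsemilattices, possibly empty: the sets
closed under binary joins, which is Mathlib's `SupClosed`. A topologized semilattice is locally
convex if every point has a neighbourhood basis of convex sets. -/
def LocallyConvexSemilattice (K : Type*) [SemilatticeSup K] [TopologicalSpace K] : Prop :=
  ∀ x : K, (𝓝 x).HasBasis (fun C : Set K => C ∈ 𝓝 x ∧ SupClosed C) id

section TopologicalSemilattice

variable {K : Type*} [SemilatticeSup K] [TopologicalSpace K] [T2Space K] [ContinuousSup K]

/-! For (1), the elements of `A` below `x`, if any, have a greatest one `a`, and an open ideal `W`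
around `a` stays below some `s` with `¬ x ≤ s`. The compact set `A \ W` has no element below `x`,
nor below a suitable `t` dominating a neighbourhood of `x`. Take `V = W ∪ (Set.Iic t)ᶜ`. Part (2)
follows by covering `B` by complements of closures of such `V`. -/

theorem isClosed_setOf_le_of_continuousSup (x : K) : IsClosed {y : K | y ≤ x} := by
  simp only [← sup_eq_right]
  exact isClosed_eq (continuous_id.sup continuous_const) continuous_const

theorem isClosed_setOf_ge_of_continuousSup (x : K) : IsClosed {y : K | x ≤ y} := by
  simp only [← sup_eq_right]
  exact isClosed_eq (continuous_const.sup continuous_id) continuous_id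

omit [T2Space K] in
theorem SupClosed.topologicalClosure {C : Set K} (hC : SupClosed C) : SupClosed (closure C) :=
  fun _ ha _ hb ↦ map_mem_closure₂ continuous_sup ha hb fun _ ha _ hb ↦ hC ha hb

/-- A nonempty compact subsemilattice has a greatest element. -/
theorem IsCompact.exists_isGreatest_of_supClosed {C : Set K} (hC : IsCompact C)
    (hsup : SupClosed C) (hne : C.Nonempty) : ∃ t, IsGreatest C t := by
  have : Nonempty C := hne.to_subtype
  -- A point in all upper sections of `C` is its maximum; joins make the sections directed.
  obtain ⟨t, ht⟩ := IsCompact.nonempty_iInter_of_directed_nonempty_isCompact_isClosed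
    (fun y : C ↦ C ∩ {z | y.1 ≤ z})
    (fun y z ↦ ⟨⟨y.1 ⊔ z.1, hsup y.2 z.2⟩,
      fun _ h ↦ ⟨h.1, le_sup_left.trans h.2⟩, fun _ h ↦ ⟨h.1, le_sup_right.trans h.2⟩⟩)
    (fun y ↦ ⟨y.1, y.2, le_rfl⟩)
    (fun y ↦ hC.inter_right (isClosed_setOf_ge_of_continuousSup _))
    (fun y ↦ hC.isClosed.inter (isClosed_setOf_ge_of_continuousSup _))
  rw [Set.mem_iInter] at ht
  exact ⟨t, (ht (Classical.arbitrary C)).1, fun y hy ↦ (ht ⟨y, hy⟩).2⟩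

/-- Every neighbourhood of `x` contains a point `t` such that all points near `x` are below `t`. -/
theorem LocallyConvexSemilattice.exists_mem_Iic_mem_nhds [LocallyCompactSpace K]
    (hK : LocallyConvexSemilattice K) {x : K} {U : Set K} (hU : U ∈ 𝓝 x) :
    ∃ t ∈ U, Set.Iic t ∈ 𝓝 x := by
  obtain ⟨L, hL, hLU, hLc⟩ := local_compact_nhds hU
  obtain ⟨C, ⟨hC, hCsup⟩, hCL⟩ := (hK x).mem_iff.1 hL
  have hcl : closure C ⊆ L := closure_minimal hCL hLc.isClosed
  obtain ⟨t, htC, ht⟩ := (hLc.of_isClosed_subset isClosed_closure hcl).exists_isGreatest_of_supClosed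
    hCsup.topologicalClosure ⟨x, subset_closure (mem_of_mem_nhds hC)⟩
  exact ⟨t, hLU (hcl htC), Filter.mem_of_superset hC fun y hy ↦ ht (subset_closure hy)⟩

theorem LocallyConvexSemilattice.exists_Iic_mem_nhds_disjoint [LocallyCompactSpace K]
    (hK : LocallyConvexSemilattice K) {x : K} {A : Set K} (hA : IsCompact A)
    (hx : ∀ a ∈ A, ¬ a ≤ x) : ∃ t, Set.Iic t ∈ 𝓝 x ∧ ∀ a ∈ A, ¬ a ≤ t := by
  refine hA.induction_on (p := fun S ↦ ∃ t, Set.Iic t ∈ 𝓝 x ∧ ∀ a ∈ S, ¬ a ≤ t) ?_ ?_ ?_ ?_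
  · obtain ⟨t, -, ht⟩ := hK.exists_mem_Iic_mem_nhds (x := x) Filter.univ_mem
    exact ⟨t, ht, by simp⟩
  · rintro S T hST ⟨t, ht, h⟩
    exact ⟨t, ht, fun a ha ↦ h a (hST ha)⟩
  -- Choosing `u` in both neighbourhoods of `x` puts it below `s` and `t`.
  · rintro S T ⟨s, hs, hS⟩ ⟨t, ht, hT⟩
    obtain ⟨u, ⟨hus, hut⟩, hu⟩ := hK.exists_mem_Iic_mem_nhds (Filter.inter_mem hs ht)
    refine ⟨u, hu, ?_⟩
    rintro a (ha | ha) hau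
    · exact hS a ha (hau.trans hus)
    · exact hT a ha (hau.trans hut)
  · intro a ha
    obtain ⟨t, hat, ht⟩ := hK.exists_mem_Iic_mem_nhds
      ((isClosed_setOf_ge_of_continuousSup a).isOpen_compl.mem_nhds (hx a ha))
    exact ⟨{y | y ≤ t}ᶜ, mem_nhdsWithin_of_mem_nhds
      ((isClosed_setOf_le_of_continuousSup t).isOpen_compl.mem_nhds hat), t, ht, fun _ h ↦ h⟩

/-- Below any `s` that dominates a neighbourhood of `a` there is an open ideal containing `a`. -/
theorem LocallyConvexSemilattice.exists_isOpen_ideal [LocallyCompactSpace K]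
    (hK : LocallyConvexSemilattice K) {a s : K} (has : Set.Iic s ∈ 𝓝 a) :
    ∃ V : Set K, IsOpen V ∧ SupClosed V ∧ IsLowerSet V ∧ a ∈ V ∧ V ⊆ Set.Iic s := by
  have step (b : {b : K // Set.Iic s ∈ 𝓝 b}) :
      ∃ c : {c : K // Set.Iic s ∈ 𝓝 c}, Set.Iic c.1 ∈ 𝓝 b.1 := by
    obtain ⟨c, hc, hbc⟩ := hK.exists_mem_Iic_mem_nhds (interior_mem_nhds.2 b.2)
    exact ⟨⟨c, mem_interior_iff_mem_nhds.1 hc⟩, hbc⟩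
  choose f hf using step
  let u : ℕ → {b : K // Set.Iic s ∈ 𝓝 b} := fun n ↦ f^[n] ⟨a, has⟩
  have hu (n : ℕ) : Set.Iic (u (n + 1)).1 ∈ 𝓝 (u n).1 := by
    -- Each `u (n + 1)` dominates a neighbourhood of `u n`; this makes the ideal generated by the
    -- chain open.
    simp only [u, Function.iterate_succ_apply']
    exact hf _
  have hmono : Monotone fun n ↦ (u n).1 :=
    monotone_nat_of_le_succ fun n ↦ Set.mem_Iic.1 (mem_of_mem_nhds (hu n))
  refine ⟨{y | ∃ n, y ≤ (u n).1}, ?_, ?_, ?_, ⟨0, le_rfl⟩, ?_⟩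
  · refine isOpen_iff_mem_nhds.2 ?_
    rintro y ⟨n, hn⟩
    -- For `z` near `y`, the join `z ⊔ u n` is near `y ⊔ u n = u n`, hence below `u (n + 1)`.
    have hc : Filter.Tendsto (fun z ↦ z ⊔ (u n).1) (𝓝 y) (𝓝 (u n).1) := by
      have : Continuous fun z ↦ z ⊔ (u n).1 := continuous_id.sup continuous_const
      simpa [sup_eq_right.2 hn] using this.tendsto y
    filter_upwards [hc (hu n)] with z hz
    exact ⟨n + 1, le_sup_left.trans hz⟩
  · rintro y ⟨m, hm⟩ z ⟨n, hn⟩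
    exact ⟨max m n, sup_le (hm.trans (hmono (le_max_left _ _)))
      (hn.trans (hmono (le_max_right _ _)))⟩
  · rintro y z hzy ⟨n, hn⟩
    exact ⟨n, hzy.trans hn⟩
  · rintro y ⟨n, hn⟩
    exact hn.trans (Set.mem_Iic.1 (mem_of_mem_nhds (u n).2))

theorem LocallyConvexSemilattice.exists_isOpen_supClosed_notMem_closure [LocallyCompactSpace K]
    (hK : LocallyConvexSemilattice K) {A : Set K} {x : K} (hA : IsCompact A)
    (hsup : SupClosed A) (hx : x ∉ A) :
    ∃ V : Set K, IsOpen V ∧ SupClosed V ∧ A ⊆ V ∧ x ∉ closure V := by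
  obtain ⟨W, hWo, hWsup, hAW, hxW⟩ :
      ∃ W : Set K, IsOpen W ∧ SupClosed W ∧ (∀ y ∈ A, y ≤ x → y ∈ W) ∧ x ∉ closure W := by
    rcases (A ∩ {y | y ≤ x}).eq_empty_or_nonempty with hempty | hne
    · exact ⟨∅, isOpen_empty, supClosed_empty,
        fun y hy hyx ↦ (hempty.subset ⟨hy, hyx⟩ : y ∈ (∅ : Set K)), by simp⟩
    · obtain ⟨a, ⟨haA, hax⟩, ha⟩ :=
        (hA.inter_right (isClosed_setOf_le_of_continuousSup x)).exists_isGreatest_of_supClosed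
          (fun y hy z hz ↦ ⟨hsup hy.1 hz.1, sup_le hy.2 hz.2⟩) hne
      have hxa : ¬ x ≤ a := fun h ↦ hx (hax.antisymm h ▸ haA)
      obtain ⟨s, hxs, has⟩ := hK.exists_mem_Iic_mem_nhds
        ((isClosed_setOf_ge_of_continuousSup x).isOpen_compl.mem_nhds hxa)
      obtain ⟨W, hWo, hWsup, hWl, haW, hWs⟩ := hK.exists_isOpen_ideal has
      exact ⟨W, hWo, hWsup, fun y hy hyx ↦ hWl (ha ⟨hy, hyx⟩) haW,
        fun h ↦ hxs (closure_minimal hWs (isClosed_setOf_le_of_continuousSup s) h)⟩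
  obtain ⟨t, ht, hAt⟩ := hK.exists_Iic_mem_nhds_disjoint (x := x) (hA.diff hWo)
    fun y hy hyx ↦ hy.2 (hAW y hy.1 hyx)
  refine ⟨W ∪ (Set.Iic t)ᶜ, hWo.union (isClosed_setOf_le_of_continuousSup t).isOpen_compl,
    ?_, ?_, ?_⟩
  -- The complement of `Set.Iic t` absorbs joins with any element, so only two points of `W` need
  -- convexity.
  · rintro y (hy | hy) z (hz | hz)
    · exact Or.inl (hWsup hy hz)
    · exact Or.inr fun h ↦ hz (le_sup_right.trans h)
    · exact Or.inr fun h ↦ hy (le_sup_left.trans h)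
    · exact Or.inr fun h ↦ hy (le_sup_left.trans h)
  · intro y hy
    by_cases hyW : y ∈ W
    · exact Or.inl hyW
    · exact Or.inr (hAt y ⟨hy, hyW⟩)
  · rw [closure_union, closure_compl]
    rintro (h | h)
    · exact hxW h
    · exact h (mem_interior_iff_mem_nhds.2 ht)

theorem LocallyConvexSemilattice.exists_isClosed_supClosed_mem_nhdsSet [LocallyCompactSpace K]
    (hK : LocallyConvexSemilattice K) {A B : Set K} (hA : IsCompact A) (hsup : SupClosed A)
    (hB : IsCompact B) (hAB : Disjoint A B) :
    ∃ N : Set K, N ∈ 𝓝ˢ A ∧ IsClosed N ∧ SupClosed N ∧ Disjoint N B := by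
  refine hB.induction_on
    (p := fun S ↦ ∃ N : Set K, N ∈ 𝓝ˢ A ∧ IsClosed N ∧ SupClosed N ∧ Disjoint N S) ?_ ?_ ?_ ?_
  · exact ⟨Set.univ, Filter.univ_mem, isClosed_univ, supClosed_univ, by simp⟩
  · rintro S T hST ⟨N, h₁, h₂, h₃, h₄⟩
    exact ⟨N, h₁, h₂, h₃, h₄.mono_right hST⟩
  · rintro S T ⟨N, h₁, h₂, h₃, h₄⟩ ⟨M, k₁, k₂, k₃, k₄⟩
    exact ⟨N ∩ M, Filter.inter_mem h₁ k₁, h₂.inter k₂, h₃.inter k₃,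
      (h₄.mono_left Set.inter_subset_left).union_right (k₄.mono_left Set.inter_subset_right)⟩
  · intro b hb
    obtain ⟨V, hVo, hVsup, hAV, hbV⟩ := hK.exists_isOpen_supClosed_notMem_closure hA hsup
      (hAB.notMem_of_mem_right hb)
    exact ⟨(closure V)ᶜ, mem_nhdsWithin_of_mem_nhds (isClosed_closure.isOpen_compl.mem_nhds hbV),
      closure V, Filter.mem_of_superset (hVo.mem_nhdsSet.2 hAV) subset_closure, isClosed_closure,
      hVsup.topologicalClosure, disjoint_compl_right⟩

end TopologicalSemilattice

theorem mainTheorem8 (K : Type*) [SemilatticeSup K] [TopologicalSpace K] [T2Space K]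
    [ContinuousSup K] (hK : LocallyConvexSemilattice K) :
    (LocallyCompactSpace K →
      ∀ (A : Set K) (x : K), IsCompact A → SupClosed A → x ∉ A →
        ∃ V : Set K, IsOpen V ∧ SupClosed V ∧ A ⊆ V ∧ x ∉ closure V) ∧
    (CompactSpace K →
      ∀ A B : Set K, IsClosed A → SupClosed A → IsClosed B → SupClosed B → Disjoint A B →
        ∃ N : Set K, N ∈ 𝓝ˢ A ∧ IsClosed N ∧ SupClosed N ∧ Disjoint N B) :=
  ⟨fun _ _ _ hA hsup hx ↦ hK.exists_isOpen_supClosed_notMem_closure hA hsup hx,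
    fun _ _ _ hA hsup hB _ hAB ↦
      hK.exists_isClosed_supClosed_mem_nhdsSet hA.isCompact hsup hB.isCompact hAB⟩
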